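/- Let $\Omega\subset\mathbb{R}^d$, $d\in\{2,3\}$, be a polygonal/polyhedral domain whose boundary is divided into disjoint measurable parts $\Gamma_D\neq\emptyset$ and $\Gamma_N$, with $\partial\Omega=\bar\Gamma_D\cup\bar\Gamma_N$ and $\partial\Omega\setminus(\Gamma_D\cup\Gamma_N)$ of surface measure zero. Let $\nu\in L^\infty(\Omega)$ be bounded below by a positive constant, $f,f^O\in L^2(\Omega)$, $g_N,g_N^O\in L^2(\Gamma_N)$ and $g_D,g_D^O\in H^{1/2}(\Gamma_D)$ (restrictions to $\Gamma_D$ of traces of $H^1(\Omega)$ functions). Let $\mathcal W=H^1(\Omega)$ and $\mathcal V=H(\mathrm{div};\Omega)$. Write $(\cdot,\cdot)$ for the $L^2(\Omega)$ inner products, $\|\boldsymbol F\|=(\nu^{-1}\boldsymbol F,\boldsymbol F)^{1/2}$ for the energy norm of vector fields, and $\langle g,w\rangle_\Gamma=\int_\Gamma gw$. For $\boldsymbol v\in\mathcal V$ the pairings $\langle\boldsymbol v\cdot\boldsymbol n,\cdot\rangle_{\Gamma_D}$ and $\langle\boldsymbol v\cdot\boldsymbol n,\cdot\rangle_{\Gamma_N}$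 are linear functionals on $H^{1/2}(\Gamma_D)$ and $H^{1/2}(\Gamma_N)$ that satisfy the Green formula $$(\boldsymbol v,\nabla w)+(\nabla\cdot\boldsymbol v,w)=\langle\boldsymbol v\cdot\boldsymbol n,w\rangle_{\Gamma_D}+\langle\boldsymbol v\cdot\boldsymbol n,w\rangle_{\Gamma_N}\qquad\forall w\in\mathcal W ;$$ the boundary integrals are such a pair when $\boldsymbol v\cdot\boldsymbol n\in L^2(\partial\Omega)$. Since the Green formula determines only their sum, each element of $\mathcal V$ is understood to come with such a pair, and the result holds for every choice (linear operations act on the pairs as well). Put $$a(u,\boldsymbol q;w,\boldsymbol v)=(\nu^{-1}\boldsymbol q,\boldsymbol v)-(u,\nabla\cdot\boldsymbol v)+\langle u,\boldsymbol v\cdot\boldsymbol n\rangle_{\Gamma_N}-(\boldsymbol q,\nabla w)+\langle\boldsymbol q\cdot\boldsymbol n,w\rangle_{\Gamma_D},$$ $$\ell(w,\boldsymbol v)=(f,w)-\langle g_D,\boldsymbol v\cdot\boldsymbol n\rangle_{\Gamma_D}-\langle g_N,w\rangle_{\Gamma_N},\qquad \ell^O(w,\boldsymbol v)=(f^O,w)+\langle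 g_D^O,\boldsymbol v\cdot\boldsymbol n\rangle_{\Gamma_D}+\langle g_N^O,w\rangle_{\Gamma_N}.$$ Let $(u,\boldsymbol q)$ and $(\xi,\boldsymbol\zeta)$ in $\mathcal W\times\mathcal V$ be the weak solutions of the primal and adjoint problems, that is, $a(u,\boldsymbol q;w,\boldsymbol v)=\ell(w,\boldsymbol v)$ and $a(w,\boldsymbol v;\xi,-\boldsymbol\zeta)=\ell^O(w,\boldsymbol v)$ for all $(w,\boldsymbol v)\in\mathcal W\times\mathcal V$, and let $s=\ell^O(u,\boldsymbol q)$ be the quantity of interest. Then, for any $(\tilde u_h,\tilde{\boldsymbol q}_h)$ and $(\tilde\xi_h,\tilde{\boldsymbol\zeta}_h)$ in $\mathcal W\times\mathcal V$ and any $\kappa\in(0,+\infty)$, both for the upper and for the lower choice of all signs, $$\begin{aligned}\pm s={}&\pm\hat s_h^{\mp}+\frac1{4\kappa}\|\boldsymbol e_{\varphi}^{\mp}-\nu\nabla e_\phi^{\mp}\|^2+\bigl(u,\ \pm(f^O-\nabla\cdot\tilde{\boldsymbol\zeta}_h)-\kappa(f-\nabla\cdot\tilde{\boldsymbol q}_h)\bigr)\\&-\bigl\langle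 u,\ \mp(g_N^O+\tilde{\boldsymbol\zeta}_h\cdot\boldsymbol n)-\kappa(g_N-\tilde{\boldsymbol q}_h\cdot\boldsymbol n)\bigr\rangle_{\Gamma_N}-\bigl\langle\boldsymbol q\cdot\boldsymbol n,\ \mp(g_D^O-\tilde\xi_h)-\kappa(g_D-\tilde u_h)\bigr\rangle_{\Gamma_D},\end{aligned}$$ where $$\pm\hat s_h^{\mp}=\pm\ell(\tilde\xi_h,-\tilde{\boldsymbol\zeta}_h)+\kappa\,\ell(\tilde u_h,\tilde{\boldsymbol q}_h)-\frac1{4\kappa}\bigl\|\pm(\tilde{\boldsymbol\zeta}_h+\nu\nabla\tilde\xi_h)-\kappa(\tilde{\boldsymbol q}_h-\nu\nabla\tilde u_h)\bigr\|^2,$$ $e_\phi^{\mp}=\mp(\xi-\tilde\xi_h)-\kappa(u-\tilde u_h)$ and $\boldsymbol e_{\varphi}^{\mp}=\pm(\boldsymbol\zeta-\tilde{\boldsymbol\zeta}_h)-\kappa(\boldsymbol q-\tilde{\boldsymbol q}_h)$. -/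

import Mathlib

open MeasureTheory Filter Topology Set
open scoped ENNReal ContDiff RealInnerProductSpace Gradient

noncomputable section

namespace PoissonQoI

/-- The Euclidean space `ℝᵈ`. -/
abbrev Sp (d : ℕ) : Type := EuclideanSpace ℝ (Fin d)

variable {d : ℕ}

/-! ### The domain, its boundary and the diffusivity -/

/-- A polygonal (`d = 2`) or polyhedral (`d = 3`) domain: a non-empty bounded connected open set
without slits (it is the interior of its closure) whose boundary is contained in a finite union
of hyperplanes `{x | ⟪a, x⟫ = b}`, `a ≠ 0`. -/
structure IsPolyhedralDomain (Ω : Set (Sp d)) : Prop where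
  isOpen : IsOpen Ω
  isConnected : IsConnected Ω
  isBounded : Bornology.IsBounded Ω
  interior_closure : interior (closure Ω) = Ω
  frontier_subset : ∃ S : Finset (Sp d × ℝ), (∀ p ∈ S, p.1 ≠ 0) ∧
    frontier Ω ⊆ ⋃ p ∈ S, {x : Sp d | ⟪p.1, x⟫ = p.2}

/-- Lebesgue measure on `Ω`. -/
abbrev vol (Ω : Set (Sp d)) : Measure (Sp d) := volume.restrict Ω

/-- Surface measure on `∂Ω`: the `(d-1)`-dimensional Hausdorff measure, normalized so as to be the
usual length (`d = 2`) or area (`d = 3`). -/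
abbrev surf (Ω : Set (Sp d)) : Measure (Sp d) := (μHE[d - 1]).restrict (frontier Ω)

/-- Surface measure on a part `Γ` of the boundary. -/
abbrev surfOn (Ω Γ : Set (Sp d)) : Measure (Sp d) := (surf Ω).restrict Γ

/-- `∂Ω` is divided into the disjoint parts `Γ_D ≠ ∅` and `Γ_N`. -/
structure IsBoundaryPartition (Ω ΓD ΓN : Set (Sp d)) : Prop where
  subset_D : ΓD ⊆ frontier Ω
  subset_N : ΓN ⊆ frontier Ω
  measurable_D : MeasurableSet ΓD
  measurable_N : MeasurableSet ΓN
  disjoint : Disjoint ΓD ΓN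
  cover : frontier Ω = closure ΓD ∪ closure ΓN
  interface_null : surf Ω (frontier Ω \ (ΓD ∪ ΓN)) = 0
  nonempty_D : ΓD.Nonempty

/-- `ν ∈ L^∞(Ω)`, bounded below by a positive constant. -/
structure IsDiffusivity (Ω : Set (Sp d)) (ν : Sp d → ℝ) : Prop where
  aestronglyMeasurable : AEStronglyMeasurable ν (vol Ω)
  bounds : ∃ c C : ℝ, 0 < c ∧ ∀ᵐ x ∂(vol Ω), c ≤ ν x ∧ ν x ≤ C

/-! ### The space `H¹(Ω)`, with traces -/

/-- `L²(Ω)`. -/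
abbrev L2 (Ω : Set (Sp d)) : Type := Lp ℝ 2 (vol Ω)

/-- `L²(Ω)ᵈ`. -/
abbrev L2v (Ω : Set (Sp d)) : Type := Lp (Sp d) 2 (vol Ω)

/-- `L²(∂Ω)`. -/
abbrev L2bd (Ω : Set (Sp d)) : Type := Lp ℝ 2 (surf Ω)

/-- `L²(Γ)` for a part `Γ` of the boundary. -/
abbrev L2on (Ω Γ : Set (Sp d)) : Type := Lp ℝ 2 (surfOn Ω Γ)

/-- Test functions `φ ∈ C_c^∞(Ω)`. -/
def IsTest (Ω : Set (Sp d)) (φ : Sp d → ℝ) : Prop :=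
  ContDiff ℝ ∞ φ ∧ HasCompactSupport φ ∧ tsupport φ ⊆ Ω

/-- `G` is the weak gradient of `w` in `Ω`. -/
def IsWeakGrad (Ω : Set (Sp d)) (w : L2 Ω) (G : L2v Ω) : Prop :=
  ∀ φ : Sp d → ℝ, IsTest Ω φ → ∫ x in Ω, w x • ∇ φ x = -∫ x in Ω, φ x • G x

/-- `g ∈ L²(∂Ω)` is the trace of the function `w`, whose gradient is `G`: some functions smooth up
to the boundary converge to `w` in `H¹(Ω)` while their boundary values converge to `g` in
`L²(∂Ω)`. -/
def IsTrace (Ω : Set (Sp d)) (w : L2 Ω) (G : L2v Ω) (g : L2bd Ω) : Prop :=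
  ∃ φ : ℕ → Sp d → ℝ, (∀ n, ContDiff ℝ ∞ (φ n)) ∧
    Tendsto (fun n => eLpNorm (fun x => φ n x - w x) 2 (vol Ω)) atTop (𝓝 0) ∧
    Tendsto (fun n => eLpNorm (fun x => ∇ (φ n) x - G x) 2 (vol Ω)) atTop (𝓝 0) ∧
    Tendsto (fun n => eLpNorm (fun x => φ n x - g x) 2 (surf Ω)) atTop (𝓝 0)

lemma integrable_test_smul {Ω : Set (Sp d)} {φ : Sp d → ℝ} (hφ : IsTest Ω φ) (G : L2v Ω) :
    Integrable (fun x => φ x • G x) (vol Ω) := by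
  have h1 : MemLp φ 2 (vol Ω) :=
    (hφ.1.continuous.memLp_of_hasCompactSupport hφ.2.1).restrict Ω
  exact memLp_one_iff_integrable.1 ((Lp.memLp G).smul h1)

lemma memLp_test_gradient {Ω : Set (Sp d)} {φ : Sp d → ℝ} (hφ : IsTest Ω φ) :
    MemLp (∇ φ) 2 (vol Ω) := by
  have hc : Continuous (∇ φ) :=
    (InnerProductSpace.toDual ℝ (Sp d)).symm.continuous.comp
      (hφ.1.continuous_fderiv (by simp))
  have hs : HasCompactSupport (∇ φ) :=
    (hφ.2.1.fderiv ℝ).comp_left (g := (InnerProductSpace.toDual ℝ (Sp d)).symm) (by simp)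
  exact (hc.memLp_of_hasCompactSupport hs).restrict Ω

lemma integrable_smul_test_gradient {Ω : Set (Sp d)} {φ : Sp d → ℝ} (hφ : IsTest Ω φ)
    (w : L2 Ω) : Integrable (fun x => w x • ∇ φ x) (vol Ω) :=
  memLp_one_iff_integrable.1 ((memLp_test_gradient hφ).smul (Lp.memLp w))

lemma IsWeakGrad.add {Ω : Set (Sp d)} {w w' : L2 Ω} {G G' : L2v Ω}
    (h : IsWeakGrad Ω w G) (h' : IsWeakGrad Ω w' G') : IsWeakGrad Ω (w + w') (G + G') := by
  intro φ hφ
  have e1 : ∫ x in Ω, (w + w') x • ∇ φ x = ∫ x in Ω, (w x • ∇ φ x + w' x • ∇ φ x) :=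
    integral_congr_ae (by
      filter_upwards [Lp.coeFn_add w w'] with x hx
      rw [hx, Pi.add_apply, add_smul])
  have e2 : ∫ x in Ω, φ x • (G + G') x = ∫ x in Ω, (φ x • G x + φ x • G' x) :=
    integral_congr_ae (by
      filter_upwards [Lp.coeFn_add G G'] with x hx
      rw [hx, Pi.add_apply, smul_add])
  rw [e1, e2, integral_add (integrable_smul_test_gradient hφ w)
    (integrable_smul_test_gradient hφ w'), integral_add (integrable_test_smul hφ G)
    (integrable_test_smul hφ G'), h φ hφ, h' φ hφ, neg_add]

lemma IsWeakGrad.smul {Ω : Set (Sp d)} {w : L2 Ω} {G : L2v Ω} (c : ℝ)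
    (h : IsWeakGrad Ω w G) : IsWeakGrad Ω (c • w) (c • G) := by
  intro φ hφ
  have e1 : ∫ x in Ω, (c • w) x • ∇ φ x = ∫ x in Ω, c • (w x • ∇ φ x) :=
    integral_congr_ae (by
      filter_upwards [Lp.coeFn_smul c w] with x hx
      rw [hx, Pi.smul_apply, smul_assoc])
  have e2 : ∫ x in Ω, φ x • (c • G) x = ∫ x in Ω, c • (φ x • G x) :=
    integral_congr_ae (by
      filter_upwards [Lp.coeFn_smul c G] with x hx
      rw [hx, Pi.smul_apply, smul_comm])
  rw [e1, e2, integral_smul, integral_smul, h φ hφ, smul_neg]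

lemma tendsto_eLpNorm_add {F : Type*} [NormedAddCommGroup F] {μ : Measure (Sp d)}
    {a a' : ℕ → Sp d → F} {f f' : Lp F 2 μ}
    (ha : ∀ n, Continuous (a n)) (ha' : ∀ n, Continuous (a' n))
    [SecondCountableTopologyEither (Sp d) F]
    (h : Tendsto (fun n => eLpNorm (fun x => a n x - f x) 2 μ) atTop (𝓝 0))
    (h' : Tendsto (fun n => eLpNorm (fun x => a' n x - f' x) 2 μ) atTop (𝓝 0)) :
    Tendsto (fun n => eLpNorm (fun x => (a n x + a' n x) - (f + f') x) 2 μ) atTop (𝓝 0) := by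
  have h0 := h.add h'
  rw [add_zero] at h0
  refine tendsto_of_tendsto_of_tendsto_of_le_of_le tendsto_const_nhds h0
    (fun _ => zero_le) (fun n => ?_)
  have e : (fun x => (a n x + a' n x) - (f + f') x) =ᵐ[μ]
      ((fun x => a n x - f x) + fun x => a' n x - f' x) := by
    filter_upwards [Lp.coeFn_add f f'] with x hx
    rw [hx]
    simp only [Pi.add_apply]
    abel
  change eLpNorm (fun x => (a n x + a' n x) - (f + f') x) 2 μ ≤ _
  rw [eLpNorm_congr_ae e]
  exact eLpNorm_add_le ((ha n).aestronglyMeasurable.sub (Lp.aestronglyMeasurable f))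
    ((ha' n).aestronglyMeasurable.sub (Lp.aestronglyMeasurable f')) (by norm_num)

lemma tendsto_eLpNorm_smul {F : Type*} [NormedAddCommGroup F] [NormedSpace ℝ F]
    {μ : Measure (Sp d)} {a : ℕ → Sp d → F} {f : Lp F 2 μ} (c : ℝ)
    (h : Tendsto (fun n => eLpNorm (fun x => a n x - f x) 2 μ) atTop (𝓝 0)) :
    Tendsto (fun n => eLpNorm (fun x => c • a n x - (c • f) x) 2 μ) atTop (𝓝 0) := by
  have h0 := ENNReal.Tendsto.const_mul (a := ‖c‖ₑ) h (Or.inr enorm_ne_top)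
  rw [mul_zero] at h0
  refine h0.congr (fun n => ?_)
  have e : (fun x => c • a n x - (c • f) x) =ᵐ[μ] (c • fun x => a n x - f x) := by
    filter_upwards [Lp.coeFn_smul c f] with x hx
    rw [hx]
    simp only [Pi.smul_apply, smul_sub]
  rw [eLpNorm_congr_ae e, eLpNorm_const_smul]

lemma continuous_gradient {φ : Sp d → ℝ} (hφ : ContDiff ℝ ∞ φ) : Continuous (∇ φ) :=
  (InnerProductSpace.toDual ℝ (Sp d)).symm.continuous.comp (hφ.continuous_fderiv (by simp))

lemma gradient_add' {φ ψ : Sp d → ℝ} (hφ : ContDiff ℝ ∞ φ) (hψ : ContDiff ℝ ∞ ψ) (x : Sp d) :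
    ∇ (fun y => φ y + ψ y) x = ∇ φ x + ∇ ψ x := by
  simp only [gradient]
  rw [fderiv_fun_add (hφ.differentiable (by simp) x) (hψ.differentiable (by simp) x), map_add]

lemma gradient_smul' {φ : Sp d → ℝ} (hφ : ContDiff ℝ ∞ φ) (c : ℝ) (x : Sp d) :
    ∇ (fun y => c • φ y) x = c • ∇ φ x := by
  simp only [gradient]
  rw [fderiv_fun_const_smul (hφ.differentiable (by simp) x)]
  simp

lemma IsTrace.add {Ω : Set (Sp d)} {w w' : L2 Ω} {G G' : L2v Ω} {g g' : L2bd Ω}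
    (h : IsTrace Ω w G g) (h' : IsTrace Ω w' G' g') :
    IsTrace Ω (w + w') (G + G') (g + g') := by
  obtain ⟨φ, hφ, h1, h2, h3⟩ := h
  obtain ⟨ψ, hψ, k1, k2, k3⟩ := h'
  refine ⟨fun n x => φ n x + ψ n x, fun n => (hφ n).add (hψ n),
    tendsto_eLpNorm_add (fun n => (hφ n).continuous) (fun n => (hψ n).continuous) h1 k1, ?_,
    tendsto_eLpNorm_add (fun n => (hφ n).continuous) (fun n => (hψ n).continuous) h3 k3⟩
  simp only [gradient_add' (hφ _) (hψ _)]
  exact tendsto_eLpNorm_add (fun n => continuous_gradient (hφ n))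
    (fun n => continuous_gradient (hψ n)) h2 k2

lemma IsTrace.smul {Ω : Set (Sp d)} {w : L2 Ω} {G : L2v Ω} {g : L2bd Ω} (c : ℝ)
    (h : IsTrace Ω w G g) : IsTrace Ω (c • w) (c • G) (c • g) := by
  obtain ⟨φ, hφ, h1, h2, h3⟩ := h
  refine ⟨fun n x => c • φ n x, fun n => (hφ n).const_smul c, tendsto_eLpNorm_smul c h1, ?_,
    tendsto_eLpNorm_smul c h3⟩
  simp only [gradient_smul' (hφ _)]
  exact tendsto_eLpNorm_smul c h2

lemma isTrace_zero (Ω : Set (Sp d)) : IsTrace Ω 0 0 0 := by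
  have key : ∀ {F : Type} [NormedAddCommGroup F] (μ : Measure (Sp d)),
      eLpNorm (fun x => (0 : F) - (0 : Lp F 2 μ) x) 2 μ = 0 := by
    intro F _ μ
    rw [eLpNorm_congr_ae (g := 0) (by filter_upwards [Lp.coeFn_zero F 2 μ] with x hx; rw [hx]; simp)]
    exact eLpNorm_zero
  have hg : ∀ x : Sp d, ∇ (fun _ : Sp d => (0 : ℝ)) x = 0 := fun x => by simp [gradient]
  refine ⟨fun _ _ => 0, fun _ => contDiff_const, ?_, ?_, ?_⟩
  · simp only [key]; exact tendsto_const_nhds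
  · simp only [hg, key]; exact tendsto_const_nhds
  · simp only [key]; exact tendsto_const_nhds

/-- The space `𝒲 = H¹(Ω)`. An element is recorded as the triple consisting of the function, its
weak gradient and its trace on `∂Ω`; on a polyhedral domain the first component determines the
other two, and every function with a weak gradient in `L²` has a trace. -/
def H1 (Ω : Set (Sp d)) : Submodule ℝ (L2 Ω × L2v Ω × L2bd Ω) where
  carrier := {p | IsWeakGrad Ω p.1 p.2.1 ∧ IsTrace Ω p.1 p.2.1 p.2.2}
  add_mem' h h' := ⟨h.1.add h'.1, h.2.add h'.2⟩
  zero_mem' := by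
    refine ⟨?_, isTrace_zero Ω⟩
    have h : IsWeakGrad Ω ((0 : ℝ) • (0 : L2 Ω)) ((0 : ℝ) • (0 : L2v Ω)) := by
      intro φ _
      rw [zero_smul, zero_smul]
      have e1 : ∫ x in Ω, (0 : L2 Ω) x • ∇ φ x = 0 := by
        rw [integral_congr_ae (g := 0) (by
          filter_upwards [Lp.coeFn_zero ℝ 2 (vol Ω)] with x hx
          rw [hx]
          simp)]
        simp
      have e2 : ∫ x in Ω, φ x • (0 : L2v Ω) x = 0 := by
        rw [integral_congr_ae (g := 0) (by
          filter_upwards [Lp.coeFn_zero (Sp d) 2 (vol Ω)] with x hx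
          rw [hx]
          simp)]
        simp
      rw [e1, e2, neg_zero]
    simpa using h
  smul_mem' c _ h := ⟨h.1.smul c, h.2.smul c⟩

/-- The function itself, in `L²(Ω)`. -/
def val {Ω : Set (Sp d)} (w : H1 Ω) : L2 Ω := w.1.1

/-- The weak gradient `∇w`. -/
def grad {Ω : Set (Sp d)} (w : H1 Ω) : L2v Ω := w.1.2.1

/-- The restriction of the trace to `Γ ⊆ ∂Ω`, as a linear map `H¹(Ω) → L²(Γ)`. -/
def traceL2 (Ω Γ : Set (Sp d)) : H1 Ω →ₗ[ℝ] L2on Ω Γ :=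
  ((LpToLpRestrictCLM (Sp d) ℝ ℝ (surf Ω) 2 Γ : L2bd Ω →L[ℝ] L2on Ω Γ) :
      L2bd Ω →ₗ[ℝ] L2on Ω Γ) ∘ₗ
    LinearMap.snd ℝ (L2v Ω) (L2bd Ω) ∘ₗ LinearMap.snd ℝ (L2 Ω) (L2v Ω × L2bd Ω) ∘ₗ
      (H1 Ω).subtype

/-- `H^{1/2}(Γ) ⊆ L²(Γ)`: the restrictions to `Γ` of the traces of the functions in `H¹(Ω)`. -/
def Hhalf (Ω Γ : Set (Sp d)) : Submodule ℝ (L2on Ω Γ) := LinearMap.range (traceL2 Ω Γ)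

/-- The trace `w|_Γ` of `w ∈ H¹(Ω)`, in `H^{1/2}(Γ)`. -/
def tr {Ω : Set (Sp d)} (Γ : Set (Sp d)) : H1 Ω →ₗ[ℝ] Hhalf Ω Γ := (traceL2 Ω Γ).rangeRestrict

/-- A function `g ∈ L²(Γ)` as the functional `w ↦ ⟨g, w⟩_Γ = ∫_Γ g w` on `H^{1/2}(Γ)`. -/
def bdPairing {Ω Γ : Set (Sp d)} (g : L2on Ω Γ) : Hhalf Ω Γ →ₗ[ℝ] ℝ :=
  (innerₗ (L2on Ω Γ) g) ∘ₗ (Hhalf Ω Γ).subtype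

/-! ### The space `H(div; Ω)`, with normal traces -/

/-- `δ` is the weak divergence of `v` in `Ω`. -/
def IsWeakDiv (Ω : Set (Sp d)) (v : L2v Ω) (δ : L2 Ω) : Prop :=
  ∀ φ : Sp d → ℝ, IsTest Ω φ → ∫ x in Ω, ⟪v x, ∇ φ x⟫ = -∫ x in Ω, δ x * φ x

lemma isWeakDiv_iff {Ω : Set (Sp d)} {v : L2v Ω} {δ : L2 Ω} :
    IsWeakDiv Ω v δ ↔ ∀ (φ : Sp d → ℝ) (hφ : IsTest Ω φ),
      ⟪v, (memLp_test_gradient hφ).toLp⟫ =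
        -⟪δ, ((hφ.1.continuous.memLp_of_hasCompactSupport (p := 2)
          (μ := (volume : Measure (Sp d))) hφ.2.1).restrict Ω).toLp⟫ := by
  refine forall_congr' fun φ => forall_congr' fun hφ => ?_
  rw [L2.inner_def, L2.inner_def]
  have e1 : ∫ x in Ω, ⟪v x, (memLp_test_gradient hφ).toLp (∇ φ) x⟫ =
      ∫ x in Ω, ⟪v x, ∇ φ x⟫ :=
    integral_congr_ae (by
      filter_upwards [(memLp_test_gradient (Ω := Ω) hφ).coeFn_toLp] with x hx
      rw [hx])
  have e2 : ∫ x in Ω, ⟪δ x, ((hφ.1.continuous.memLp_of_hasCompactSupport (p := 2)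
      (μ := (volume : Measure (Sp d))) hφ.2.1).restrict Ω).toLp φ x⟫ = ∫ x in Ω, δ x * φ x :=
    integral_congr_ae (by
      filter_upwards [((hφ.1.continuous.memLp_of_hasCompactSupport (p := 2)
        (μ := (volume : Measure (Sp d))) hφ.2.1).restrict Ω).coeFn_toLp] with x hx
      rw [hx, real_inner_eq_re_inner ℝ]
      simp [mul_comm])
  rw [e1, e2]

/-- The space `𝒱 = H(div; Ω)`. An element is recorded as a square integrable field `v` together with
its weak divergence `∇·v ∈ L²(Ω)` and its normal traces `⟨v·n, ·⟩` on `Γ_D` and on `Γ_N`, which are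
linear functionals on `H^{1/2}(Γ_D)` and `H^{1/2}(Γ_N)` related by the Green formula
`(v, ∇w) + (∇·v, w) = ⟨v·n, w⟩_{Γ_D} + ⟨v·n, w⟩_{Γ_N}` for all `w ∈ H¹(Ω)`.

When `v·n` is a square integrable function, `⟨v·n, w⟩_Γ = ∫_Γ (v·n) w` is such a pair. In general
the Green formula determines only the pairing over the whole of `∂Ω`, and an element of the space
carries one of its decompositions into a pairing over `Γ_D` and one over `Γ_N`; every field with a
square integrable divergence on a polyhedral domain has one. -/
def Hdiv (Ω ΓD ΓN : Set (Sp d)) :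
    Submodule ℝ (L2v Ω × L2 Ω × (Hhalf Ω ΓD →ₗ[ℝ] ℝ) × (Hhalf Ω ΓN →ₗ[ℝ] ℝ)) where
  carrier := {p | IsWeakDiv Ω p.1 p.2.1 ∧
    ∀ w : H1 Ω, ⟪p.1, grad w⟫ + ⟪p.2.1, val w⟫ = p.2.2.1 (tr ΓD w) + p.2.2.2 (tr ΓN w)}
  add_mem' {p q} hp hq := by
    refine ⟨isWeakDiv_iff.2 fun φ hφ => ?_, fun w => ?_⟩
    · have h1 := isWeakDiv_iff.1 hp.1 φ hφ
      have h2 := isWeakDiv_iff.1 hq.1 φ hφ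
      simp only [Prod.fst_add, Prod.snd_add, inner_add_left]
      rw [h1, h2, neg_add]
    · have h1 := hp.2 w
      have h2 := hq.2 w
      simp only [Prod.fst_add, Prod.snd_add, inner_add_left, LinearMap.add_apply]
      linarith
  zero_mem' := by
    refine ⟨isWeakDiv_iff.2 fun φ hφ => ?_, fun w => ?_⟩ <;> simp
  smul_mem' c p hp := by
    refine ⟨isWeakDiv_iff.2 fun φ hφ => ?_, fun w => ?_⟩
    · have h1 := isWeakDiv_iff.1 hp.1 φ hφ
      simp only [Prod.smul_fst, Prod.smul_snd, real_inner_smul_left]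
      rw [h1, mul_neg]
    · have h1 := hp.2 w
      simp only [Prod.smul_fst, Prod.smul_snd, real_inner_smul_left, LinearMap.smul_apply,
        smul_eq_mul]
      rw [← mul_add, ← mul_add, h1]

variable {Ω ΓD ΓN : Set (Sp d)}

/-- The vector field itself, in `L²(Ω)ᵈ`. -/
def field (v : Hdiv Ω ΓD ΓN) : L2v Ω := v.1.1

/-- The divergence `∇·v`. -/
def dvg (v : Hdiv Ω ΓD ΓN) : L2 Ω := v.1.2.1

/-- The normal trace `⟨v·n, ·⟩_{Γ_D}`. -/
def nD (v : Hdiv Ω ΓD ΓN) : Hhalf Ω ΓD →ₗ[ℝ] ℝ := v.1.2.2.1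

/-- The normal trace `⟨v·n, ·⟩_{Γ_N}`. -/
def nN (v : Hdiv Ω ΓD ΓN) : Hhalf Ω ΓN →ₗ[ℝ] ℝ := v.1.2.2.2

/-! ### Forms, weak solutions and the quantity of interest -/

/-- The energy norm `‖F‖ = (ν⁻¹F, F)^{1/2}` of a vector field. -/
def energyNorm (Ω : Set (Sp d)) (ν : Sp d → ℝ) (F : Sp d → Sp d) : ℝ :=
  Real.sqrt (∫ x in Ω, (ν x)⁻¹ * ⟪F x, F x⟫)

/-- The bilinear form `a(u,q; w,v) =
(ν⁻¹q, v) - (u, ∇·v) + ⟨u, v·n⟩_{Γ_N} - (q, ∇w) + ⟨q·n, w⟩_{Γ_D}`. -/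
def form (ν : Sp d → ℝ) (u : H1 Ω) (q : Hdiv Ω ΓD ΓN) (w : H1 Ω) (v : Hdiv Ω ΓD ΓN) : ℝ :=
  (∫ x in Ω, (ν x)⁻¹ * ⟪field q x, field v x⟫) - ⟪val u, dvg v⟫ + nN v (tr ΓN u)
    - ⟪field q, grad w⟫ + nD q (tr ΓD w)

/-- The load `ℓ(w,v) = (f, w) - ⟨g_D, v·n⟩_{Γ_D} - ⟨g_N, w⟩_{Γ_N}`. -/
def load (f : L2 Ω) (gD : Hhalf Ω ΓD) (gN : L2on Ω ΓN) (w : H1 Ω) (v : Hdiv Ω ΓD ΓN) : ℝ :=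
  ⟪f, val w⟫ - nD v gD - bdPairing gN (tr ΓN w)

/-- The output functional `ℓᴼ(w,v) = (fᴼ, w) + ⟨g_Dᴼ, v·n⟩_{Γ_D} + ⟨g_Nᴼ, w⟩_{Γ_N}`. -/
def output (fO : L2 Ω) (gDO : Hhalf Ω ΓD) (gNO : L2on Ω ΓN) (w : H1 Ω) (v : Hdiv Ω ΓD ΓN) : ℝ :=
  ⟪fO, val w⟫ + nD v gDO + bdPairing gNO (tr ΓN w)

/-- `(u, q)` is the weak solution of the primal problem: `a(u,q; w,v) = ℓ(w,v)` for all `(w,v)`. -/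
def IsPrimalSolution (ν : Sp d → ℝ) (f : L2 Ω) (gD : Hhalf Ω ΓD) (gN : L2on Ω ΓN)
    (u : H1 Ω) (q : Hdiv Ω ΓD ΓN) : Prop :=
  ∀ (w : H1 Ω) (v : Hdiv Ω ΓD ΓN), form ν u q w v = load f gD gN w v

/-- `(ξ, ζ)` is the weak solution of the adjoint problem: `a(w,v; ξ,-ζ) = ℓᴼ(w,v)` for all
`(w,v)`. -/
def IsAdjointSolution (ν : Sp d → ℝ) (fO : L2 Ω) (gDO : Hhalf Ω ΓD) (gNO : L2on Ω ΓN)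
    (ξ : H1 Ω) (ζ : Hdiv Ω ΓD ΓN) : Prop :=
  ∀ (w : H1 Ω) (v : Hdiv Ω ΓD ΓN), form ν w v ξ (-ζ) = output fO gDO gNO w v

/-- The quantity `ŝ` of the sign `ε = ±1` (`ε = 1` gives `ŝ⁻`, `ε = -1` gives `ŝ⁺`), for the
approximations `(u', q')` and `(ξ', ζ')`: `ε ŝ = ε ℓ(ξ', -ζ') + κ ℓ(u', q')
- (4κ)⁻¹ ‖ε (ζ' + ν∇ξ') - κ (q' - ν∇u')‖²`. -/
def sHat (ν : Sp d → ℝ) (f : L2 Ω) (gD : Hhalf Ω ΓD) (gN : L2on Ω ΓN) (κ ε : ℝ)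
    (u' : H1 Ω) (q' : Hdiv Ω ΓD ΓN) (ξ' : H1 Ω) (ζ' : Hdiv Ω ΓD ΓN) : ℝ :=
  ε * (ε * load f gD gN ξ' (-ζ') + κ * load f gD gN u' q'
    - 1 / (4 * κ) * energyNorm Ω ν (fun x =>
        ε • (field ζ' x + ν x • grad ξ' x) - κ • (field q' x - ν x • grad u' x)) ^ 2)

/-- `e_φ = -ε (ξ - ξ') - κ (u - u')`. -/
def ePot (κ ε : ℝ) (u ξ u' ξ' : H1 Ω) : H1 Ω := -ε • (ξ - ξ') - κ • (u - u')

/-- `e_𝛗 = ε (ζ - ζ') - κ (q - q')`. -/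
def eFlux (κ ε : ℝ) (q ζ q' ζ' : Hdiv Ω ΓD ΓN) : Hdiv Ω ΓD ΓN := ε • (ζ - ζ') - κ • (q - q')

end PoissonQoI

end

open PoissonQoI

namespace PoissonQoI

variable {d : ℕ} {Ω ΓD ΓN : Set (Sp d)} {ν : Sp d → ℝ}

/-! The identity is a completed square. The weak problems force `q = -ν∇u` and `ζ = -ν∇ξ` almost
everywhere. Let `B` be the constitutive residual inside the norm in `sHat`. When these relations are
inserted in the flux error minus `ν` times the gradient of the potential error, `ζ` cancels and
`-(2κ q + B)` remains. Hence the two squared norms, divided by `4κ`, differ by `κ(ν⁻¹q, q) + (ν⁻¹q,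
B)`. The relation `ν⁻¹q = -∇u` turns this into unweighted products of fluxes and gradients
(`energyNorm_sq_error`), which is linear in the approximations.

What remains is linear bookkeeping. Products `(q, ∇w)` with `w = u, u', ξ'` are evaluated by the
primal equation tested with `w` (`IsPrimalSolution.balance`); products of `q'` and `ζ'` with `∇u` by
the Green formula (`green`); and in normal traces on `Γ_D` the trace of `u` is exchanged for `g_D`
(`IsPrimalSolution.dirichlet`).

The constitutive relations come from testing with the fields `φ e`, `φ` a test function and `e` a
constant vector. They have zero normal traces, so the fundamental lemma of the calculus of
variations applies (`inv_smul_flux_eq_neg`). -/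

/-! ### Integrability with the weights `ν` and `ν⁻¹` -/

lemma IsDiffusivity.aestronglyMeasurable_inv (hν : IsDiffusivity Ω ν) :
    AEStronglyMeasurable (fun x => (ν x)⁻¹) (vol Ω) :=
  hν.aestronglyMeasurable.aemeasurable.inv.aestronglyMeasurable

lemma IsDiffusivity.ae_pos (hν : IsDiffusivity Ω ν) : ∀ᵐ x ∂(vol Ω), 0 < ν x := by
  obtain ⟨c, C, hc, h⟩ := hν.bounds
  filter_upwards [h] with x hx using hc.trans_le hx.1

lemma IsDiffusivity.memLp_top (hν : IsDiffusivity Ω ν) : MemLp ν ∞ (vol Ω) := by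
  obtain ⟨c, C, hc, h⟩ := hν.bounds
  refine memLp_top_of_bound hν.aestronglyMeasurable C ?_
  filter_upwards [h] with x hx
  rw [Real.norm_of_nonneg (hc.le.trans hx.1)]
  exact hx.2

lemma IsDiffusivity.memLp_top_inv (hν : IsDiffusivity Ω ν) :
    MemLp (fun x => (ν x)⁻¹) ∞ (vol Ω) := by
  obtain ⟨c, C, hc, h⟩ := hν.bounds
  refine memLp_top_of_bound hν.aestronglyMeasurable_inv c⁻¹ ?_
  filter_upwards [h] with x hx
  rw [Real.norm_of_nonneg (inv_nonneg.2 (hc.le.trans hx.1))]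
  exact inv_anti₀ hc hx.1

lemma IsDiffusivity.memLp_smul (hν : IsDiffusivity Ω ν) {F : Sp d → Sp d}
    (hF : MemLp F 2 (vol Ω)) : MemLp (fun x => ν x • F x) 2 (vol Ω) :=
  hF.smul hν.memLp_top

lemma IsDiffusivity.memLp_inv_smul (hν : IsDiffusivity Ω ν) {F : Sp d → Sp d}
    (hF : MemLp F 2 (vol Ω)) : MemLp (fun x => (ν x)⁻¹ • F x) 2 (vol Ω) :=
  hF.smul hν.memLp_top_inv

lemma integrable_inner_of_memLp {F G : Sp d → Sp d} (hF : MemLp F 2 (vol Ω))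
    (hG : MemLp G 2 (vol Ω)) : Integrable (fun x => ⟪F x, G x⟫) (vol Ω) := by
  refine (L2.integrable_inner (𝕜 := ℝ) hF.toLp hG.toLp).congr ?_
  filter_upwards [hF.coeFn_toLp, hG.coeFn_toLp] with x h1 h2
  rw [h1, h2]

lemma IsDiffusivity.integrable_inv_mul_inner (hν : IsDiffusivity Ω ν) {F G : Sp d → Sp d}
    (hF : MemLp F 2 (vol Ω)) (hG : MemLp G 2 (vol Ω)) :
    Integrable (fun x => (ν x)⁻¹ * ⟪F x, G x⟫) (vol Ω) := by
  simpa only [real_inner_smul_left] using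
    integrable_inner_of_memLp (hν.memLp_inv_smul hF) hG

/-- `Real.sqrt` truncates negative numbers to zero, so positivity of the weight is needed. No
integrability of `F` is required: a divergent integral has the value `0` on both sides. -/
lemma IsDiffusivity.energyNorm_sq (hν : IsDiffusivity Ω ν) (F : Sp d → Sp d) :
    energyNorm Ω ν F ^ 2 = ∫ x in Ω, (ν x)⁻¹ * ⟪F x, F x⟫ := by
  refine Real.sq_sqrt (integral_nonneg_of_ae ?_)
  filter_upwards [hν.ae_pos] with x hx
  exact mul_nonneg (inv_nonneg.2 hx.le) real_inner_self_nonneg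

/-! ### Test fields -/

lemma memLp_test {φ : Sp d → ℝ} (hφ : IsTest Ω φ) : MemLp φ 2 (vol Ω) :=
  (hφ.1.continuous.memLp_of_hasCompactSupport hφ.2.1).restrict Ω

lemma memLp_test_smul {φ : Sp d → ℝ} (hφ : IsTest Ω φ) (e : Sp d) :
    MemLp (fun x => φ x • e) 2 (vol Ω) :=
  ((hφ.1.continuous.smul continuous_const).memLp_of_hasCompactSupport
    (hφ.2.1.smul_right (f' := fun _ => e))).restrict Ω

lemma memLp_inner_test_gradient {φ : Sp d → ℝ} (hφ : IsTest Ω φ) (e : Sp d) :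
    MemLp (fun x => ⟪∇ φ x, e⟫) 2 (vol Ω) :=
  (memLp_test_gradient hφ).inner_const e

/-- Both integrands vanish off `Ω`, the first through `φ` and the second through `ψ`, so this is
integration by parts on the whole space, with no boundary term. It identifies `⟪∇ φ, e⟫` as the weak
divergence of `φ e`. -/
lemma setIntegral_inner_test_gradient {φ ψ : Sp d → ℝ} (hφ : IsTest Ω φ) (hψ : IsTest Ω ψ)
    (e : Sp d) :
    ∫ x in Ω, ⟪φ x • e, ∇ ψ x⟫ = -∫ x in Ω, ⟪∇ φ x, e⟫ * ψ x := by
  have hg : ∀ (χ : Sp d → ℝ) x, ⟪∇ χ x, e⟫ = fderiv ℝ χ x e := fun χ x => by simp [gradient]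
  have hfd : ∀ {χ : Sp d → ℝ}, IsTest Ω χ → Continuous fun x => fderiv ℝ χ x e := fun h =>
    (h.1.continuous_fderiv (by simp)).clm_apply continuous_const
  have e1 : ∫ x in Ω, ⟪φ x • e, ∇ ψ x⟫ = ∫ x, φ x * fderiv ℝ ψ x e := by
    rw [setIntegral_eq_integral_of_forall_compl_eq_zero]
    · simp only [real_inner_smul_left, real_inner_comm _ e, hg]
    · intro x hx
      rw [image_eq_zero_of_notMem_tsupport (fun h => hx (hφ.2.2 h)), zero_smul, inner_zero_left]
  have e2 : ∫ x in Ω, ⟪∇ φ x, e⟫ * ψ x = ∫ x, fderiv ℝ φ x e * ψ x := by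
    rw [setIntegral_eq_integral_of_forall_compl_eq_zero]
    · simp only [hg]
    · intro x hx
      rw [image_eq_zero_of_notMem_tsupport (fun h => hx (hψ.2.2 h)), mul_zero]
  rw [e1, e2]
  refine integral_mul_fderiv_eq_neg_fderiv_mul_of_integrable ?_ ?_ ?_
    (fun x _ => hφ.1.differentiable (by simp) x) (fun x _ => hψ.1.differentiable (by simp) x)
  · exact ((hfd hφ).mul hψ.1.continuous).integrable_of_hasCompactSupport hψ.2.1.mul_left
  · exact (hφ.1.continuous.mul (hfd hψ)).integrable_of_hasCompactSupport hφ.2.1.mul_right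
  · exact (hφ.1.continuous.mul hψ.1.continuous).integrable_of_hasCompactSupport
      hφ.2.1.mul_right

/-- The field `φ e` for a test function `φ` and a constant vector `e`, an element of `H(div; Ω)`
with vanishing normal traces. -/
noncomputable def testField (ΓD ΓN : Set (Sp d)) {φ : Sp d → ℝ} (hφ : IsTest Ω φ) (e : Sp d) :
    Hdiv Ω ΓD ΓN :=
  ⟨((memLp_test_smul hφ e).toLp, (memLp_inner_test_gradient hφ e).toLp, 0, 0), by
    refine ⟨fun ψ hψ => ?_, fun w => ?_⟩
    · refine Eq.trans ?_ ((setIntegral_inner_test_gradient hφ hψ e).trans (congrArg Neg.neg ?_))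
      · refine integral_congr_ae ?_
        filter_upwards [(memLp_test_smul hφ e).coeFn_toLp] with x hx
        rw [hx]
      · refine integral_congr_ae ?_
        filter_upwards [(memLp_inner_test_gradient hφ e).coeFn_toLp] with x hx
        rw [hx]
    -- With zero normal traces, the Green formula for `φ e` is the defining identity of the weak
    -- gradient of `w` for the test function `φ`, paired with `e`.
    · have h := congrArg (fun y => ⟪e, y⟫) (w.2.1 φ hφ)
      simp only [inner_neg_right] at h
      rw [← integral_inner (integrable_smul_test_gradient hφ _),
        ← integral_inner (integrable_test_smul hφ _)] at h
      simp only [LinearMap.zero_apply, add_zero, L2.inner_def]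
      rw [add_comm, ← eq_neg_iff_add_eq_zero]
      refine Eq.trans ?_ (h.trans (congrArg Neg.neg ?_))
      · refine integral_congr_ae ?_
        filter_upwards [(memLp_inner_test_gradient hφ e).coeFn_toLp] with x hx
        rw [hx, real_inner_smul_right, real_inner_comm e]
        simp [val]
      · refine integral_congr_ae ?_
        filter_upwards [(memLp_test_smul hφ e).coeFn_toLp] with x hx
        rw [hx, real_inner_smul_right, real_inner_smul_left]
        rfl⟩

lemma green (v : Hdiv Ω ΓD ΓN) (w : H1 Ω) :
    ⟪field v, grad w⟫ + ⟪dvg v, val w⟫ = nD v (tr ΓD w) + nN v (tr ΓN w) :=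
  v.2.2 w

/-- A flux which satisfies `(ν⁻¹q, v) = -(v, G)` for all fields `v` with vanishing normal traces
is `q = -ν G`. -/
lemma inv_smul_flux_eq_neg (hΩ : IsOpen Ω) (hν : IsDiffusivity Ω ν) (q G : L2v Ω)
    (h : ∀ v : Hdiv Ω ΓD ΓN, nD v = 0 → nN v = 0 →
      ∫ x in Ω, (ν x)⁻¹ * ⟪q x, field v x⟫ = -⟪field v, G⟫) :
    ∀ᵐ x ∂(vol Ω), (ν x)⁻¹ • q x = -G x := by
  have hm : MemLp (fun x => (ν x)⁻¹ • q x + G x) 2 (vol Ω) :=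
    (hν.memLp_inv_smul (Lp.memLp q)).add (Lp.memLp G)
  -- On a compact subset of `Ω` the measure is finite, so square integrability gives integrability
  -- there.
  have hloc : LocallyIntegrableOn (fun x => (ν x)⁻¹ • q x + G x) Ω := by
    rw [locallyIntegrableOn_iff hΩ.isLocallyClosed]
    intro K hK hKc
    have : IsFiniteMeasure ((volume : Measure (Sp d)).restrict K) :=
      isFiniteMeasure_restrict.2 hKc.measure_ne_top
    exact (hm.mono_measure (Measure.restrict_mono_set _ hK)).integrable (by norm_num)
  have key := hΩ.ae_eq_zero_of_integral_contDiff_smul_eq_zero hloc ?_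
  · rw [ae_restrict_iff' hΩ.measurableSet]
    filter_upwards [key] with x hx hxΩ using eq_neg_of_add_eq_zero_left (hx hxΩ)
  intro φ hφ hφc hφs
  have hT : IsTest Ω φ := ⟨hφ, hφc, hφs⟩
  have hi : Integrable (fun x => φ x • ((ν x)⁻¹ • q x + G x)) (vol Ω) :=
    memLp_one_iff_integrable.1 (hm.smul (memLp_test hT))
  rw [← setIntegral_eq_integral_of_forall_compl_eq_zero (s := Ω)]
  swap
  · intro x hx
    rw [image_eq_zero_of_notMem_tsupport (fun h => hx (hφs h)), zero_smul]
  -- The vector integral vanishes if its product with every `e` does, and that product is the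
  -- hypothesis `h` for the field `φ e`.
  refine ext_inner_left ℝ fun e => ?_
  rw [← integral_inner hi, inner_zero_right]
  have hv := h (testField ΓD ΓN hT e) rfl rfl
  have hcoe : field (testField ΓD ΓN hT e) =ᵐ[vol Ω] fun x => φ x • e :=
    (memLp_test_smul hT e).coeFn_toLp
  have i1 := hν.integrable_inv_mul_inner (Lp.memLp q) (Lp.memLp (field (testField ΓD ΓN hT e)))
  have i2 := L2.integrable_inner (𝕜 := ℝ) (field (testField ΓD ΓN hT e)) G
  rw [L2.inner_def, eq_neg_iff_add_eq_zero, ← integral_add i1 i2] at hv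
  rw [← hv]
  refine integral_congr_ae ?_
  filter_upwards [hcoe] with x hx
  simp only [hx, real_inner_smul_left, real_inner_smul_right, inner_add_right,
    real_inner_comm e]
  ring

lemma setIntegral_eq_neg_inner {q G : L2v Ω} (h : ∀ᵐ x ∂(vol Ω), (ν x)⁻¹ • q x = -G x)
    (v : L2v Ω) : ∫ x in Ω, (ν x)⁻¹ * ⟪q x, v x⟫ = -⟪v, G⟫ := by
  rw [L2.inner_def, ← integral_neg]
  refine integral_congr_ae ?_
  filter_upwards [h] with x hx
  rw [← real_inner_smul_left, hx, inner_neg_left, real_inner_comm]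

/-! ### Constitutive law, Dirichlet condition and flux balance -/

section Solutions

variable {f : L2 Ω} {gD : Hhalf Ω ΓD} {gN : L2on Ω ΓN} {u : H1 Ω} {q : Hdiv Ω ΓD ΓN}

/-- Test with `w = 0` and eliminate `(u, ∇·v)` by the Green formula; its `Γ_N` term cancels the one
in the form. -/
lemma IsPrimalSolution.constitutive_weak (h : IsPrimalSolution ν f gD gN u q)
    (v : Hdiv Ω ΓD ΓN) :
    (∫ x in Ω, (ν x)⁻¹ * ⟪field q x, field v x⟫) + ⟪field v, grad u⟫ =
      nD v (tr ΓD u) - nD v gD := by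
  have h1 := h 0 v
  have h2 := green v u
  have g0 : grad (0 : H1 Ω) = 0 := rfl
  have v0 : val (0 : H1 Ω) = 0 := rfl
  simp only [form, load, map_zero, g0, v0, inner_zero_right] at h1
  rw [real_inner_comm] at h1
  linarith

lemma IsPrimalSolution.constitutive (h : IsPrimalSolution ν f gD gN u q) (hΩ : IsOpen Ω)
    (hν : IsDiffusivity Ω ν) : ∀ᵐ x ∂(vol Ω), (ν x)⁻¹ • field q x = -grad u x := by
  refine inv_smul_flux_eq_neg (ΓD := ΓD) (ΓN := ΓN) hΩ hν _ _ fun v hD hN => ?_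
  have := h.constitutive_weak v
  rw [hD] at this
  simp only [LinearMap.zero_apply] at this
  linarith

/-- Once `ν⁻¹q = -∇u` holds pointwise, the left side of `constitutive_weak` vanishes for every `v`,
whatever its normal traces. This is `u = g_D` on `Γ_D`, tested against normal traces. -/
lemma IsPrimalSolution.dirichlet (h : IsPrimalSolution ν f gD gN u q) (hΩ : IsOpen Ω)
    (hν : IsDiffusivity Ω ν) (v : Hdiv Ω ΓD ΓN) : nD v (tr ΓD u) = nD v gD := by
  have h1 := h.constitutive_weak v
  have h2 := setIntegral_eq_neg_inner (h.constitutive hΩ hν) (field v)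
  linarith

lemma IsPrimalSolution.balance (h : IsPrimalSolution ν f gD gN u q) (w : H1 Ω) :
    -⟪field q, grad w⟫ + nD q (tr ΓD w) = ⟪f, val w⟫ - bdPairing gN (tr ΓN w) := by
  have h1 := h w 0
  have f0 : field (0 : Hdiv Ω ΓD ΓN) = 0 := rfl
  have d0 : dvg (0 : Hdiv Ω ΓD ΓN) = 0 := rfl
  have nD0 : nD (0 : Hdiv Ω ΓD ΓN) = 0 := rfl
  have nN0 : nN (0 : Hdiv Ω ΓD ΓN) = 0 := rfl
  have i0 : ∫ x in Ω, (ν x)⁻¹ * ⟪field q x, (0 : L2v Ω) x⟫ = 0 := by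
    refine integral_eq_zero_of_ae ?_
    filter_upwards [Lp.coeFn_zero (Sp d) 2 (vol Ω)] with x hx
    rw [hx, Pi.zero_apply, inner_zero_right, mul_zero]
    rfl
  simp only [form, load, f0, d0, nD0, nN0, i0, inner_zero_right, LinearMap.zero_apply] at h1
  linarith

/-- Here `∇ξ` already stands in the form, so testing with `w = 0` and a field with zero normal
traces suffices, without the Green formula. -/
lemma IsAdjointSolution.constitutive {fO : L2 Ω} {gDO : Hhalf Ω ΓD} {gNO : L2on Ω ΓN}
    {ξ : H1 Ω} {ζ : Hdiv Ω ΓD ΓN} (h : IsAdjointSolution ν fO gDO gNO ξ ζ) (hΩ : IsOpen Ω)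
    (hν : IsDiffusivity Ω ν) : ∀ᵐ x ∂(vol Ω), (ν x)⁻¹ • field ζ x = -grad ξ x := by
  refine inv_smul_flux_eq_neg (ΓD := ΓD) (ΓN := ΓN) hΩ hν _ _ fun v hD hN => ?_
  have h1 := h 0 v
  have v0 : val (0 : H1 Ω) = 0 := rfl
  have i0 : ∫ x in Ω, (ν x)⁻¹ * ⟪field v x, field (-ζ) x⟫ =
      -∫ x in Ω, (ν x)⁻¹ * ⟪field ζ x, field v x⟫ := by
    rw [← integral_neg]
    refine integral_congr_ae ?_
    filter_upwards [Lp.coeFn_neg (field ζ)] with x hx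
    have hx' : field (-ζ) x = -field ζ x := hx
    rw [hx', inner_neg_right, real_inner_comm, mul_neg]
  simp only [form, output, map_zero, hD, v0, i0, inner_zero_right, inner_zero_left,
    LinearMap.zero_apply] at h1
  linarith

end Solutions

/-! ### Completing the square in the energy norm -/

lemma coeFn_field_eFlux (κ ε : ℝ) (q ζ q' ζ' : Hdiv Ω ΓD ΓN) :
    ∀ᵐ x ∂(vol Ω), field (eFlux κ ε q ζ q' ζ') x =
      ε • (field ζ x - field ζ' x) - κ • (field q x - field q' x) := by
  have h : field (eFlux κ ε q ζ q' ζ') =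
    ε • (field ζ - field ζ') - κ • (field q - field q') := rfl
  rw [h]
  filter_upwards [Lp.coeFn_sub (ε • (field ζ - field ζ')) (κ • (field q - field q')),
    Lp.coeFn_smul ε (field ζ - field ζ'), Lp.coeFn_smul κ (field q - field q'),
    Lp.coeFn_sub (field ζ) (field ζ'), Lp.coeFn_sub (field q) (field q')] with x h1 h2 h3 h4 h5
  simp only [h1, Pi.sub_apply, h2, h3, Pi.smul_apply, h4, h5]

lemma coeFn_grad_ePot (κ ε : ℝ) (u ξ u' ξ' : H1 Ω) :
    ∀ᵐ x ∂(vol Ω), grad (ePot κ ε u ξ u' ξ') x =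
      -ε • (grad ξ x - grad ξ' x) - κ • (grad u x - grad u' x) := by
  have h : grad (ePot κ ε u ξ u' ξ') =
    (-ε) • (grad ξ - grad ξ') - κ • (grad u - grad u') := rfl
  rw [h]
  filter_upwards [Lp.coeFn_sub ((-ε) • (grad ξ - grad ξ')) (κ • (grad u - grad u')),
    Lp.coeFn_smul (-ε) (grad ξ - grad ξ'), Lp.coeFn_smul κ (grad u - grad u'),
    Lp.coeFn_sub (grad ξ) (grad ξ'), Lp.coeFn_sub (grad u) (grad u')] with x h1 h2 h3 h4 h5
  simp only [h1, Pi.sub_apply, h2, h3, Pi.smul_apply, h4, h5]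

/-- The energy norms of the error combination and of the constitutive residual of the
approximations, when the exact fluxes satisfy `q = -ν∇u` and `ζ = -ν∇ξ`. -/
lemma energyNorm_sq_error (hν : IsDiffusivity Ω ν) {u ξ : H1 Ω} {q ζ : Hdiv Ω ΓD ΓN}
    (hq : ∀ᵐ x ∂(vol Ω), (ν x)⁻¹ • field q x = -grad u x)
    (hζ : ∀ᵐ x ∂(vol Ω), (ν x)⁻¹ • field ζ x = -grad ξ x)
    (u' ξ' : H1 Ω) (q' ζ' : Hdiv Ω ΓD ΓN) (κ ε : ℝ) :
    energyNorm Ω ν (fun x =>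
        field (eFlux κ ε q ζ q' ζ') x - ν x • grad (ePot κ ε u ξ u' ξ') x) ^ 2 =
      energyNorm Ω ν (fun x =>
        ε • (field ζ' x + ν x • grad ξ' x) - κ • (field q' x - ν x • grad u' x)) ^ 2
      + 4 * κ * (κ * (⟪field q', grad u⟫ + ⟪field q, grad u'⟫ - ⟪field q, grad u⟫)
        + ε * (⟪field q, grad ξ'⟫ - ⟪field ζ', grad u⟫)) := by
  have hB : MemLp (fun x => ε • (field ζ' x + ν x • grad ξ' x)
      - κ • (field q' x - ν x • grad u' x)) 2 (vol Ω) :=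
    (((Lp.memLp (field ζ')).add (hν.memLp_smul (Lp.memLp (grad ξ')))).const_smul ε).sub
      (((Lp.memLp (field q')).sub (hν.memLp_smul (Lp.memLp (grad u')))).const_smul κ)
  have i1 := L2.integrable_inner (𝕜 := ℝ) (field q') (grad u)
  have i2 := L2.integrable_inner (𝕜 := ℝ) (field q) (grad u')
  have i3 := L2.integrable_inner (𝕜 := ℝ) (field q) (grad u)
  have i4 := L2.integrable_inner (𝕜 := ℝ) (field q) (grad ξ')
  have i5 := L2.integrable_inner (𝕜 := ℝ) (field ζ') (grad u)
  have i6 : Integrable (fun x => κ * (⟪field q' x, grad u x⟫ + ⟪field q x, grad u' x⟫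
      - ⟪field q x, grad u x⟫)) (vol Ω) := ((i1.add i2).sub i3).const_mul κ
  have i7 : Integrable (fun x => ε * (⟪field q x, grad ξ' x⟫ - ⟪field ζ' x, grad u x⟫))
      (vol Ω) := (i4.sub i5).const_mul ε
  have i8 : Integrable (fun x => ⟪field q' x, grad u x⟫ + ⟪field q x, grad u' x⟫) (vol Ω) :=
    i1.add i2
  rw [hν.energyNorm_sq, hν.energyNorm_sq]
  simp only [L2.inner_def]
  have i9 : Integrable (fun x => 4 * κ * (κ * (⟪field q' x, grad u x⟫ + ⟪field q x, grad u' x⟫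
      - ⟪field q x, grad u x⟫) + ε * (⟪field q x, grad ξ' x⟫ - ⟪field ζ' x, grad u x⟫)))
      (vol Ω) := (i6.add i7).const_mul (4 * κ)
  rw [← integral_add i1 i2, ← integral_sub i8 i3, ← integral_sub i4 i5, ← integral_const_mul,
    ← integral_const_mul, ← integral_add i6 i7, ← integral_const_mul,
    ← integral_add (hν.integrable_inv_mul_inner hB hB) i9]
  refine integral_congr_ae ?_
  filter_upwards [hν.ae_pos, hq, hζ, coeFn_field_eFlux κ ε q ζ q' ζ',
    coeFn_grad_ePot κ ε u ξ u' ξ'] with x hpos h1 h2 h3 h4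
  set B : Sp d := ε • (field ζ' x + ν x • grad ξ' x) - κ • (field q' x - ν x • grad u' x)
    with hBdef
  have hne := hpos.ne'
  have k1 : ν x • grad u x = -field q x := by
    rw [← neg_neg (grad u x), ← h1, smul_neg, smul_inv_smul₀ hne]
  have k2 : ν x • grad ξ x = -field ζ x := by
    rw [← neg_neg (grad ξ x), ← h2, smul_neg, smul_inv_smul₀ hne]
  -- The contributions of `ζ` and `-ν∇ξ` cancel, while those of `q` and `-ν∇u` add up, whence the
  -- factor `2κ`.
  have hA : field (eFlux κ ε q ζ q' ζ') x - ν x • grad (ePot κ ε u ξ u' ξ') x =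
      -((2 * κ) • field q x + B) := by
    have : ν x • grad (ePot κ ε u ξ u' ξ') x = -ε • (-field ζ x - ν x • grad ξ' x)
        - κ • (-field q x - ν x • grad u' x) := by
      rw [h4, ← k1, ← k2]
      module
    rw [h3, this, hBdef]
    module
  -- On the flux parts of `B` the weight turns `q` into `-∇u`; on the gradient parts it cancels the
  -- factor `ν`.
  have hqB : (ν x)⁻¹ * ⟪field q x, B⟫ = ε * (⟪field q x, grad ξ' x⟫ - ⟪field ζ' x, grad u x⟫)
      + κ * (⟪field q' x, grad u x⟫ + ⟪field q x, grad u' x⟫) := by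
    have e1 : ∀ y, (ν x)⁻¹ * ⟪field q x, y⟫ = -⟪y, grad u x⟫ := fun y => by
      rw [← real_inner_smul_left, h1, inner_neg_left, real_inner_comm]
    have e2 : ∀ y, (ν x)⁻¹ * ⟪field q x, ν x • y⟫ = ⟪field q x, y⟫ := fun y => by
      rw [real_inner_smul_right, inv_mul_cancel_left₀ hne]
    have e3 := e1 (field ζ' x)
    have e4 := e1 (field q' x)
    have e5 := e2 (grad ξ' x)
    have e6 := e2 (grad u' x)
    simp only [hBdef, inner_sub_right, inner_add_right, real_inner_smul_right (_ : Sp d) _ ε,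
      real_inner_smul_right (_ : Sp d) _ κ]
    linear_combination ε * e3 + ε * e5 - κ * e4 + κ * e6
  have hqq : (ν x)⁻¹ * ⟪field q x, field q x⟫ = -⟪field q x, grad u x⟫ := by
    rw [← real_inner_smul_left, h1, inner_neg_left, real_inner_comm]
  have hsq : ⟪(2 * κ) • field q x + B, (2 * κ) • field q x + B⟫ =
      4 * κ ^ 2 * ⟪field q x, field q x⟫ + 4 * κ * ⟪field q x, B⟫ + ⟪B, B⟫ := by
    rw [inner_add_left, inner_add_right, inner_add_right, real_inner_smul_left,
      real_inner_smul_left, real_inner_smul_right, real_inner_smul_right,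
      real_inner_comm (field q x) B]
    ring
  rw [hA, inner_neg_neg, hsq]
  linear_combination 4 * κ ^ 2 * hqq + 4 * κ * hqB

end PoissonQoI

theorem theorem3 {d : ℕ} (hd : d = 2 ∨ d = 3) {Ω ΓD ΓN : Set (Sp d)}
    (hΩ : IsPolyhedralDomain Ω) (hΓ : IsBoundaryPartition Ω ΓD ΓN)
    {ν : Sp d → ℝ} (hν : IsDiffusivity Ω ν)
    (f : L2 Ω) (gD : Hhalf Ω ΓD) (gN : L2on Ω ΓN)
    (fO : L2 Ω) (gDO : Hhalf Ω ΓD) (gNO : L2on Ω ΓN)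
    (u : H1 Ω) (q : Hdiv Ω ΓD ΓN) (huq : IsPrimalSolution ν f gD gN u q)
    (ξ : H1 Ω) (ζ : Hdiv Ω ΓD ΓN) (hξζ : IsAdjointSolution ν fO gDO gNO ξ ζ)
    (u' : H1 Ω) (q' : Hdiv Ω ΓD ΓN) (ξ' : H1 Ω) (ζ' : Hdiv Ω ΓD ΓN)
    (κ : ℝ) (hκ : 0 < κ) (ε : ℝ) (hε : ε = 1 ∨ ε = -1) :
    ε * output fO gDO gNO u q =
      ε * sHat ν f gD gN κ ε u' q' ξ' ζ'
      + 1 / (4 * κ) * energyNorm Ω ν (fun x =>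
          field (eFlux κ ε q ζ q' ζ') x - ν x • grad (ePot κ ε u ξ u' ξ') x) ^ 2
      + inner ℝ (val u) (ε • (fO - dvg ζ') - κ • (f - dvg q'))
      - (-ε • (bdPairing gNO + nN ζ') - κ • (bdPairing gN - nN q')) (tr ΓN u)
      - nD q (-ε • (gDO - tr ΓD ξ') - κ • (gD - tr ΓD u')) := by
  have hopen := hΩ.isOpen
  have hsq : ε * ε = 1 := by rcases hε with rfl | rfl <;> norm_num
  have hN := energyNorm_sq_error hν (huq.constitutive hopen hν) (hξζ.constitutive hopen hν)
    u' ξ' q' ζ' κ ε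
  have hdq := huq.dirichlet hopen hν q
  have hdq' := huq.dirichlet hopen hν q'
  have hdζ' := huq.dirichlet hopen hν ζ'
  have hbu := huq.balance u
  have hbu' := huq.balance u'
  have hbξ' := huq.balance ξ'
  have hgq' := green q' u
  have hgζ' := green ζ' u
  have nDneg : nD (-ζ') = -nD ζ' := rfl
  set A := energyNorm Ω ν (fun x =>
    field (eFlux κ ε q ζ q' ζ') x - ν x • grad (ePot κ ε u ξ u' ξ') x) ^ 2
  simp only [sHat, output, load, nDneg]
  set B := energyNorm Ω ν (fun x =>
    ε • (field ζ' x + ν x • grad ξ' x) - κ • (field q' x - ν x • grad u' x)) ^ 2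
  have hAB : 1 / (4 * κ) * A = 1 / (4 * κ) * B
      + (κ * (⟪field q', grad u⟫ + ⟪field q, grad u'⟫ - ⟪field q, grad u⟫)
        + ε * (⟪field q, grad ξ'⟫ - ⟪field ζ', grad u⟫)) := by
    rw [hN]
    field_simp
  -- `sHat` carries an outer factor `ε`, which `ε * ε = 1` removes.
  rw [hAB, ← mul_assoc, hsq, one_mul]
  simp only [inner_sub_left, real_inner_smul_left, map_sub, map_smul, LinearMap.sub_apply,
    LinearMap.add_apply, LinearMap.neg_apply, LinearMap.smul_apply, smul_eq_mul,
    real_inner_comm _ (val u)]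
  -- The terms with `ξ'`, `u'` and `u` come from the balance, those with `∇·ζ'` and `∇·q'` from the
  -- Green formula; the Dirichlet identities match the remaining pairings on `Γ_D`.
  linear_combination ε * hbξ' + κ * hbu' + ε * hgζ' + ε * hdζ' - κ * hgq' - κ * hdq'
    - κ * hbu + κ * hdq
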